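/- Let $R$ be a commutative Noetherian local ring with maximal ideal $\mathfrak m$. For an ideal $\mathfrak a$ of $R$ and a finitely generated $R$-module $X$, let $\operatorname{depth}_R(\mathfrak a,X)$ denote the common length of the maximal $X$-regular sequences in $\mathfrak a$ if $\mathfrak aX\neq X$, and set $\operatorname{depth}_R(\mathfrak a,X)=\infty$ if $\mathfrak aX=X$; write $\operatorname{depth}_R(X)=\operatorname{depth}_R(\mathfrak m,X)$. Let $\Omega_R X$ denote the first syzygy of $X$, i.e. the image of the first differential in a minimal free resolution of $X$ (unique up to isomorphism). Call $X$ generically free if $X_{\mathfrak p}$ is a free $R_{\mathfrak p}$-module for every associated prime $\mathfrak p$ of $R$. Let $\mathfrak a$ be an ideal of $R$ with $\operatorname{depth}_R(\mathfrak a,R)\geq 1$, and let $N$ be a nonzero finitely generated $R$-module which is generically free and satisfies $\operatorname{depth}_R(N)\geq 1$. If $M=\Omega_R(\mathfrak m N)\neq 0$, then $$\operatorname{depth}_R(\mathfrak a,M)\leq \operatorname{depth}_R(\mathfrak a,R)+1 .$$ -/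

import Mathlib

namespace DepthIneq

open IsLocalRing

universe u v w

/-- The `𝔞`-depth (grade) of the module `M`: it is `∞` if `𝔞 M = M` (in particular if `M = 0`), and
otherwise it is the supremum of the lengths of the `M`-regular sequences with all terms in `𝔞`.
(For finitely generated `M` over a Noetherian ring this is the common length of the maximal ones.) -/
noncomputable def depth {R : Type u} [CommRing R] (𝔞 : Ideal R)
    (M : Type v) [AddCommGroup M] [Module R M] : ℕ∞ :=
  open Classical in
  if 𝔞 • (⊤ : Submodule R M) = ⊤ then ⊤
  else ⨆ (rs : List R) (_ : (∀ r ∈ rs, r ∈ 𝔞) ∧ RingTheory.Sequence.IsRegular M rs),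
    (rs.length : ℕ∞)

/-- `N` is generically free: `N_𝔭` is a free `R_𝔭`-module for every associated prime `𝔭` of `R`
(for Noetherian `R` these are the primes with `depth R_𝔭 = 0`). The rank may depend on `𝔭`. -/
def GenericallyFree (R : Type u) [CommRing R] (N : Type v) [AddCommGroup N] [Module R N] : Prop :=
  ∀ (𝔭 : Ideal R) [𝔭.IsPrime], 𝔭 ∈ associatedPrimes R R →
    Module.Free (Localization.AtPrime 𝔭) (LocalizedModule.AtPrime 𝔭 N)

/-- A minimal free resolution `⋯ → R^(b 2) → R^(b 1) → R^(b 0) → X → 0` over a local ring. -/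
structure MinimalFreeResolution (R : Type u) [CommRing R] [IsLocalRing R]
    (X : Type v) [AddCommGroup X] [Module R X] where
  /-- the ranks of the free modules -/
  b : ℕ → ℕ
  /-- the differentials; `d i` is the map from degree `i + 1` to degree `i` -/
  d : ∀ i, (Fin (b (i + 1)) → R) →ₗ[R] (Fin (b i) → R)
  /-- the augmentation -/
  ε : (Fin (b 0) → R) →ₗ[R] X
  ε_surjective : Function.Surjective ε
  exact_zero : Function.Exact (d 0) ε
  exact_succ : ∀ i, Function.Exact (d (i + 1)) (d i)
  minimal : ∀ i, LinearMap.range (d i) ≤ maximalIdeal R • (⊤ : Submodule R (Fin (b i) → R))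

/-- `M` is (isomorphic to) the first syzygy module `Ω_R X`: the image of the first differential in a
minimal free resolution of `X`. -/
def IsSyzygy (R : Type u) [CommRing R] [IsLocalRing R] (X : Type v) [AddCommGroup X] [Module R X]
    (M : Type w) [AddCommGroup M] [Module R M] : Prop :=
  ∃ F : MinimalFreeResolution R X, Nonempty (M ≃ₗ[R] LinearMap.range (F.d 0))

end DepthIneq

namespace DepthIneq

open IsLocalRing RingTheory.Sequence

/-! The syzygy `K` of `𝔪N` never admits a weakly regular sequence of length three in `𝔪`, so its
`𝔞`-depth is at most 2 ≤ depth(𝔞, R) + 1 when `𝔞` is proper. Given such a sequence z₁, z₂, z₃, prime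
avoidance replaces z₃ by an N-regular y with yN ⊄ 𝔪²N. For yn ∉ 𝔪²N, the class of yn is a socle
element of 𝔪N/y𝔪N. Since K/yK has depth at least 2, Ext¹(k, K/yK) = 0 for the residue field k, so
this class lifts to a socle element of F/yF, F being the free cover. The lift has a unit coordinate,
whence 𝔪 = (y), K = yK and K = 0 (`eq_bot_of_residue_element`, which does the lifting by hand). -/

theorem exists_isRegular_of_lt_depth {R M : Type*} [CommRing R] [AddCommGroup M] [Module R M]
    {𝔞 : Ideal R} (h𝔞 : 𝔞 • (⊤ : Submodule R M) ≠ ⊤) {n : ℕ} (h : (n : ℕ∞) < depth 𝔞 M) :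
    ∃ rs : List R, n < rs.length ∧ (∀ r ∈ rs, r ∈ 𝔞) ∧ IsRegular M rs := by
  rw [depth, if_neg h𝔞] at h
  obtain ⟨rs, h⟩ := lt_iSup_iff.1 h
  obtain ⟨hrs, h⟩ := lt_iSup_iff.1 h
  exact ⟨rs, by exact_mod_cast h, hrs⟩

theorem smul_top_ne_top {R M : Type*} [CommRing R] [IsLocalRing R] [AddCommGroup M] [Module R M]
    [Module.Finite R M] [Nontrivial M] {𝔞 : Ideal R} (h𝔞 : 𝔞 ≤ maximalIdeal R) :
    𝔞 • (⊤ : Submodule R M) ≠ ⊤ := fun h ↦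
  top_ne_bot (Submodule.eq_bot_of_le_smul_of_le_jacobson_bot 𝔞 ⊤ Module.Finite.fg_top h.ge
    (h𝔞.trans (maximalIdeal_le_jacobson ⊥)))

/-- If `depth M ≥ 1` then the maximal ideal contains an `M`-regular element. -/
theorem exists_isSMulRegular_of_one_le_depth {R M : Type*} [CommRing R] [IsLocalRing R]
    [AddCommGroup M] [Module R M] [Module.Finite R M] [Nontrivial M] {𝔞 : Ideal R}
    (h𝔞 : 𝔞 ≤ maximalIdeal R) (h : 1 ≤ depth 𝔞 M) :
    ∃ r ∈ maximalIdeal R, IsSMulRegular M r := by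
  obtain ⟨rs, hlen, hmem, hreg⟩ := exists_isRegular_of_lt_depth (n := 0) (smul_top_ne_top h𝔞)
    (lt_of_lt_of_le (by simp) h)
  match rs with
  | r :: rs =>
    exact ⟨r, h𝔞 (hmem r (by simp)), ((isWeaklyRegular_cons_iff M r rs).1 hreg.1).1⟩

/-- If the maximal ideal is not associated to `P` and not contained in `J`, then it contains a
`P`-regular element outside `J`. -/
theorem exists_isSMulRegular_notMem {R P : Type*} [CommRing R] [IsLocalRing R] [IsNoetherianRing R]
    [AddCommGroup P] [Module R P] [Module.Finite R P] {J : Ideal R} (hJ : ¬ maximalIdeal R ≤ J)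
    (hP : ∀ v : P, (∀ r ∈ maximalIdeal R, r • v = 0) → v = 0) :
    ∃ y ∈ maximalIdeal R, y ∉ J ∧ IsSMulRegular P y := by
  by_contra! hcon
  have hsub : (maximalIdeal R : Set R) ⊆
      ⋃ I ∈ insert J (associatedPrimes R P), ((id I : Ideal R) : Set R) := by
    intro y hy
    rw [Set.biUnion_insert]
    by_cases hyJ : y ∈ J
    · exact Or.inl hyJ
    · right
      have hmem : y ∈ ⋃ p ∈ associatedPrimes R P, (p : Set R) := by
        rw [biUnion_associatedPrimes_eq_compl_regular]
        exact hcon y hy hyJ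
      exact hmem
  -- Prime avoidance permits up to two non-prime ideals; `J` fills both slots.
  obtain ⟨I, hI, hle⟩ := (Ideal.subset_union_prime_finite
    ((associatedPrimes.finite R P).insert J) (f := id) J J (by
      rintro I (rfl | hI) h _
      · exact absurd rfl h
      · exact hI.isPrime)).1 hsub
  rcases hI with rfl | hI
  · exact hJ hle
  · have hI' := hI
    rw [AssociatedPrimes.mem_iff, isAssociatedPrime_iff] at hI'
    obtain ⟨hprime, v, hv⟩ := hI'
    have hv0 : v = 0 := hP v fun r hr ↦ by
      have : r ∈ I := hle hr
      rw [hv] at this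
      simpa [Submodule.mem_colon_singleton] using this
    apply hprime.ne_top
    rw [hv, hv0]
    ext r
    simp

theorem mem_ofList_pair_smul_top {R M : Type*} [CommRing R] [AddCommGroup M] [Module R M]
    {a b : R} {x : M} : x ∈ Ideal.ofList [a, b] • (⊤ : Submodule R M) ↔
      ∃ u v : M, a • u + b • v = x := by
  rw [Ideal.ofList_cons_smul, Ideal.ofList_singleton, Submodule.ideal_span_singleton_smul]
  simp [Submodule.mem_sup, Submodule.mem_smul_pointwise_iff_exists]

theorem mem_ofList_singleton_smul_top {R M : Type*} [CommRing R] [AddCommGroup M] [Module R M]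
    {a : R} {x : M} : x ∈ Ideal.ofList [a] • (⊤ : Submodule R M) ↔ ∃ u : M, a • u = x := by
  rw [Ideal.ofList_singleton, Submodule.ideal_span_singleton_smul]
  simp [Submodule.mem_smul_pointwise_iff_exists]

theorem mem_smul_top_pi {R ι : Type*} [CommRing R] [Fintype ι] [DecidableEq ι] {I : Ideal R}
    {f : ι → R} : f ∈ I • (⊤ : Submodule R (ι → R)) ↔ ∀ i, f i ∈ I := by
  constructor
  · intro hf i
    exact Submodule.smul_induction_on hf (fun r hr g _ ↦ I.mul_mem_right (g i) hr)
      fun _ _ h₁ h₂ ↦ I.add_mem h₁ h₂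
  · intro hf
    rw [pi_eq_sum_univ' f]
    exact Submodule.sum_mem _ fun i _ ↦ Submodule.smul_mem_smul (hf i) trivial

/-- Let `K ⊆ 𝔪 Rⁿ`, with `y` regular on `Rⁿ / K`, and with `y, z₁, z₂` a `K`-regular
sequence. If `f ∉ 𝔪 Rⁿ` spans the residue field modulo `K + y Rⁿ`, then `f` can be corrected by an
element of `K` so as to be a socle element modulo `y`; this forces `𝔪 = (y)` and `K = 0`. -/
theorem eq_bot_of_residue_element {R ι : Type*} [CommRing R] [IsLocalRing R] [IsNoetherianRing R]
    [Fintype ι] [DecidableEq ι] {K : Submodule R (ι → R)}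
    (hK : K ≤ maximalIdeal R • (⊤ : Submodule R (ι → R)))
    {y z₁ z₂ : R} (hy : y ∈ maximalIdeal R) (hz₁ : z₁ ∈ maximalIdeal R) (hz₂ : z₂ ∈ maximalIdeal R)
    (hyK : ∀ f, y • f ∈ K → f ∈ K) (hreg : IsWeaklyRegular K [y, z₁, z₂])
    {f : ι → R} (hf : f ∉ maximalIdeal R • (⊤ : Submodule R (ι → R)))
    (hfK : ∀ r ∈ maximalIdeal R, ∃ h, r • f - y • h ∈ K) : K = ⊥ := by
  have reg₁ : ∀ k ∈ K, ∀ k' ∈ K, z₁ • k = y • k' → ∃ w ∈ K, k = y • w := by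
    intro k hk k' hk' h
    obtain ⟨w, hw⟩ := mem_ofList_singleton_smul_top.1
      ((isSMulRegular_quotient_iff_mem_of_smul_mem _ _).1
        (hreg.regular_mod_prev 1 (by simp)) ⟨k, hk⟩
        (mem_ofList_singleton_smul_top.2 ⟨⟨k', hk'⟩, Subtype.ext h.symm⟩))
    exact ⟨w, w.2, (congrArg Subtype.val hw).symm⟩
  have reg₂ : ∀ k ∈ K, ∀ a ∈ K, ∀ b ∈ K, z₂ • k = y • a + z₁ • b →
      ∃ u ∈ K, ∃ v ∈ K, k = y • u + z₁ • v := by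
    intro k hk a ha b hb h
    obtain ⟨u, v, hw⟩ := mem_ofList_pair_smul_top.1
      ((isSMulRegular_quotient_iff_mem_of_smul_mem _ _).1
        (hreg.regular_mod_prev 2 (by simp)) ⟨k, hk⟩
        (mem_ofList_pair_smul_top.2 ⟨⟨a, ha⟩, ⟨b, hb⟩, Subtype.ext h.symm⟩))
    exact ⟨u, u.2, v, v.2, (congrArg Subtype.val hw).symm⟩
  obtain ⟨h₁, hk₁⟩ := hfK z₁ hz₁
  obtain ⟨h₂, hk₂⟩ := hfK z₂ hz₂
  have hmem : z₁ • h₂ - z₂ • h₁ ∈ K := by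
    apply hyK
    have : y • (z₁ • h₂ - z₂ • h₁) = z₂ • (z₁ • f - y • h₁) - z₁ • (z₂ • f - y • h₂) := by
      module
    rw [this]
    exact K.sub_mem (K.smul_mem _ hk₁) (K.smul_mem _ hk₂)
  -- The Koszul relation between the elements for z₁ and z₂ yields the correction `u`: z₁(f - u) is
  -- divisible by y.
  obtain ⟨v, hv, u, hu, huv⟩ := reg₂ _ hk₁ _ hmem _ hk₂ (by module)
  -- Regularity of z₁ on K/yK extends this divisibility from z₁ to every r in `𝔪`.
  have hsocle : ∀ r ∈ maximalIdeal R, ∃ h, r • (f - u) = y • h := by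
    intro r hr
    obtain ⟨h, hk⟩ := hfK r hr
    have e : z₁ • (r • f - y • h - r • u) = y • (r • (h₁ + v) - z₁ • h) := by
      linear_combination (norm := module) r • huv
    have hk' : r • f - y • h - r • u ∈ K := K.sub_mem hk (K.smul_mem _ hu)
    obtain ⟨w, -, hw⟩ := reg₁ _ hk' _ (hyK _ (e ▸ K.smul_mem _ hk')) e
    refine ⟨h + w, ?_⟩
    linear_combination (norm := module) hw
  have hfu : f - u ∉ maximalIdeal R • (⊤ : Submodule R (ι → R)) := fun h ↦
    hf (by simpa using Submodule.add_mem _ h (hK hu))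
  rw [mem_smul_top_pi] at hfu
  push Not at hfu
  obtain ⟨i, hi⟩ := hfu
  obtain ⟨c, hc⟩ := (notMem_maximalIdeal.1 hi).exists_left_inv
  -- Read off at the unit coordinate `i` of f - u.
  have hdvd : ∀ r ∈ maximalIdeal R, ∃ s, r = y * s := by
    intro r hr
    obtain ⟨h, hh⟩ := hsocle r hr
    refine ⟨c * h i, ?_⟩
    have := congrFun hh i
    simp only [Pi.smul_apply, smul_eq_mul] at this
    linear_combination c * this - r * hc
  refine Submodule.eq_bot_of_le_smul_of_le_jacobson_bot (Ideal.span {y}) K (IsNoetherian.noetherian K)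
    ?_ (((Ideal.span_singleton_le_iff_mem _).2 hy).trans (maximalIdeal_le_jacobson ⊥))
  -- K ⊆ 𝔪Rⁿ = yRⁿ, and y is regular on Rⁿ/K, so K ⊆ yK.
  intro k hk
  choose s hs using fun i ↦ hdvd (k i) (mem_smul_top_pi.1 (hK hk) i)
  have hks : k = y • s := funext hs
  rw [hks]
  exact Submodule.smul_mem_smul (Ideal.mem_span_singleton_self y) (hyK s (hks ▸ hk))

/-- The depth of the first syzygy of `𝔪 N` is at most two when `N` has positive depth. -/
theorem not_isWeaklyRegular_syzygy {R N M : Type*} [CommRing R] [IsLocalRing R] [IsNoetherianRing R]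
    [AddCommGroup N] [Module R N] [Module.Finite R N] [Nontrivial N]
    [AddCommGroup M] [Module R M] [Nontrivial M]
    (hN : ∃ r ∈ maximalIdeal R, IsSMulRegular N r)
    (hM : IsSyzygy R ↥(maximalIdeal R • (⊤ : Submodule R N)) M)
    {z₁ z₂ z₃ : R} (hz₁ : z₁ ∈ maximalIdeal R) (hz₂ : z₂ ∈ maximalIdeal R)
    (hz₃ : z₃ ∈ maximalIdeal R) : ¬ IsWeaklyRegular M [z₁, z₂, z₃] := by
  intro hreg
  obtain ⟨F, ⟨e⟩⟩ := hM
  set K := LinearMap.range (F.d 0) with hKdef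
  have hker : LinearMap.ker F.ε = K := F.exact_zero.linearMap_ker_eq
  rw [e.isWeaklyRegular_congr] at hreg
  have : Nontrivial K := e.symm.toEquiv.nontrivial
  obtain ⟨s, hs, hsN⟩ := hN
  let 𝔪 := maximalIdeal R
  let J : Ideal R := (𝔪 • 𝔪 • (⊤ : Submodule R N)).colon Set.univ
  have hJ : ¬ 𝔪 ≤ J := by
    intro hle
    have hbot : 𝔪 • (⊤ : Submodule R N) = ⊥ := by
      refine Submodule.eq_bot_of_le_smul_of_le_jacobson_bot 𝔪 _ (IsNoetherian.noetherian _) ?_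
        (maximalIdeal_le_jacobson ⊥)
      exact Submodule.smul_le.2 fun t ht n _ ↦ Submodule.mem_colon.1 (hle ht) n trivial
    obtain ⟨n, hn⟩ := exists_ne (0 : N)
    have : s • n ∈ (⊥ : Submodule R N) := hbot ▸ Submodule.smul_mem_smul hs trivial
    exact hn (hsN.right_eq_zero_of_smul this)
  let Q := K ⧸ (Ideal.ofList [z₁, z₂] • (⊤ : Submodule R K))
  have hz₃Q : IsSMulRegular Q z₃ := hreg.regular_mod_prev 2 (by simp)
  -- Taking the product N × Q makes one element regular on both factors.
  obtain ⟨y, hy, hyJ, hyreg⟩ := exists_isSMulRegular_notMem (P := N × Q) hJ (by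
    rintro ⟨n, q⟩ h
    have hn := h s hs
    have hq := h z₃ hz₃
    simp only [Prod.smul_mk, Prod.mk_eq_zero] at hn hq ⊢
    exact ⟨hsN.right_eq_zero_of_smul hn.1, hz₃Q.right_eq_zero_of_smul hq.2⟩)
  have hyN : IsSMulRegular N y := fun a b h ↦
    congrArg (fun p : N × Q ↦ p.1)
      (hyreg (a₁ := (a, 0)) (a₂ := (b, 0)) (by simpa using h))
  have hyQ : IsSMulRegular Q y := fun a b h ↦
    congrArg (fun p : N × Q ↦ p.2)
      (hyreg (a₁ := (0, a)) (a₂ := (0, b)) (by simpa using h))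
  have hreg' : IsWeaklyRegular K [z₁, z₂, y] := by
    have h12 := (isWeaklyRegular_append_iff K [z₁, z₂] [z₃]).1 hreg
    exact (isWeaklyRegular_append_iff K [z₁, z₂] [y]).2
      ⟨h12.1, (isWeaklyRegular_singleton_iff _ y).2 hyQ⟩
  have hreg'' : IsWeaklyRegular K [y, z₁, z₂] :=
    IsLocalRing.isWeaklyRegular_of_perm_of_subset_maximalIdeal hreg'
      (List.perm_append_comm (l₁ := [z₁, z₂]) (l₂ := [y])) (by
        simp only [List.forall_mem_cons]
        exact ⟨hz₁, hz₂, hy, by simp⟩)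
  obtain ⟨n, hn⟩ : ∃ n : N, y • n ∉ 𝔪 • 𝔪 • (⊤ : Submodule R N) := by
    by_contra! h
    exact hyJ (Submodule.mem_colon.2 fun n _ ↦ h n)
  obtain ⟨f, hf⟩ := F.ε_surjective ⟨y • n, Submodule.smul_mem_smul hy trivial⟩
  have hbot : K = ⊥ := by
    refine eq_bot_of_residue_element (F.minimal 0) hy hz₁ hz₂ (f := f) ?_ hreg'' ?_ ?_
    · intro g hg
      rw [← hker, LinearMap.mem_ker, map_smul] at hg
      rw [← hker, LinearMap.mem_ker]
      exact Subtype.ext (hyN.right_eq_zero_of_smul (congrArg Subtype.val hg))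
    -- `F.ε` carries 𝔪F into 𝔪²N, which does not contain yn.
    · intro hmem
      have h1 := Submodule.mem_map_of_mem
        (f := (𝔪 • (⊤ : Submodule R N)).subtype ∘ₗ F.ε) hmem
      rw [Submodule.map_smul''] at h1
      apply hn
      have h2 : ((𝔪 • (⊤ : Submodule R N)).subtype ∘ₗ F.ε) f = y • n := by simp [hf]
      rw [h2] at h1
      refine Submodule.smul_mono le_rfl ?_ h1
      rintro _ ⟨g, -, rfl⟩
      exact (F.ε g).2
    -- If g lifts tn, then tf and yg both lift tyn.
    · intro t ht
      obtain ⟨g, hg⟩ := F.ε_surjective ⟨t • n, Submodule.smul_mem_smul ht trivial⟩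
      refine ⟨g, ?_⟩
      rw [← hker, LinearMap.mem_ker, map_sub, map_smul, map_smul, hf, hg]
      exact Subtype.ext (by simp [smul_comm t y n])
  exact Submodule.nontrivial_iff_ne_bot.1 this hbot

end DepthIneq

theorem corollary3p6 {R : Type*} [CommRing R] [IsLocalRing R] [IsNoetherianRing R]
    (𝔞 : Ideal R) (h𝔞 : 1 ≤ DepthIneq.depth 𝔞 R)
    {N : Type*} [AddCommGroup N] [Module R N] [Module.Finite R N] [Nontrivial N]
    (hfree : DepthIneq.GenericallyFree R N)
    (hN : 1 ≤ DepthIneq.depth (IsLocalRing.maximalIdeal R) N)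
    {M : Type*} [AddCommGroup M] [Module R M] [Nontrivial M]
    (hM : DepthIneq.IsSyzygy R ↥(IsLocalRing.maximalIdeal R • (⊤ : Submodule R N)) M) :
    DepthIneq.depth 𝔞 M ≤ DepthIneq.depth 𝔞 R + 1 := by
  rcases eq_or_ne 𝔞 ⊤ with rfl | hne
  -- For the unit ideal the right-hand side is ∞ by convention.
  · simp [DepthIneq.depth]
  have hle := IsLocalRing.le_maximalIdeal hne
  have : Module.Finite R M := by
    obtain ⟨F, ⟨e⟩⟩ := hM
    exact Module.Finite.equiv e.symm
  by_contra! hlt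
  have h2 : ((2 : ℕ) : ℕ∞) < DepthIneq.depth 𝔞 M :=
    lt_of_le_of_lt (by simpa [one_add_one_eq_two] using add_le_add_left h𝔞 1) hlt
  obtain ⟨rs, hlen, hmem, hreg⟩ :=
    DepthIneq.exists_isRegular_of_lt_depth (DepthIneq.smul_top_ne_top hle) h2
  match rs with
  | z₁ :: z₂ :: z₃ :: rs =>
    refine DepthIneq.not_isWeaklyRegular_syzygy
      (DepthIneq.exists_isSMulRegular_of_one_le_depth le_rfl hN) hM
      (hle (hmem z₁ (by simp))) (hle (hmem z₂ (by simp))) (hle (hmem z₃ (by simp)))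
      ((RingTheory.Sequence.isWeaklyRegular_append_iff M [z₁, z₂, z₃] rs).1 hreg.1).1
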